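/- Let $n,p,s,c\ge 0$ be integers, $n_c=p+s+3c$, and index the coordinates of $\mathbb R^{n_c}$ by $p$ hard constraints (one coordinate each), $s$ soft constraints (one coordinate each) and $c$ contacts (three coordinates each, two tangential ones, written $w_{i,t}\in\mathbb R^2$, and one normal one, written $w_{i,n}\in\mathbb R$). Given are errors $e_i\in\mathbb R$ for the hard and the soft constraints, gains $k_i>0$ and dampings $b_i>0$ for the soft constraints, and normal errors $e_{i,n}\in\mathbb R$ and friction coefficients $\mu_i\ge 0$ for the contacts. Let $\mathcal S_c\subset\mathbb R^{n_c}\times\mathbb R^{n_c}$ be the set of all pairs $(z,\lambda)$ such that - for every hard constraint $i$: $\lambda_i\ge 0$, $z_i+e_i\ge 0$ and $\lambda_i(z_i+e_i)=0$; - for every soft constraint $i$: $\lambda_i=-k_ie_i-b_iz_i$; - for every contact $i$ (Signorini–Coulomb condition): $\lambda_{i,n}\ge 0$, $z_{i,n}+e_{i,n}\ge 0$, $\lambda_{i,n}(z_{i,n}+e_{i,n})=0$, and there is $\delta_i\in\mathbb R$ with $\delta_i\ge 0$, $\mu_i\lambda_{i,n}-\|\lambda_{i,t}\|\ge 0$,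 $\delta_i(\mu_i\lambda_{i,n}-\|\lambda_{i,t}\|)=0$ and $\delta_i\lambda_{i,t}+\mu_i\lambda_{i,n}z_{i,t}=0$, where $\|\cdot\|$ is the Euclidean norm on $\mathbb R^2$. Then for every symmetric positive definite $A\in\mathbb R^{n\times n}$, every $b\in\mathbb R^n$, every $J\in\mathbb R^{n_c\times n}$, every $\beta>0$ and every $u\in\mathbb R^{n_c}$, the augmented-Lagrangian surrogate problem $$\begin{bmatrix}A+\beta J^TJ & -\beta J^T\\ -\beta J & \beta I\end{bmatrix}\begin{bmatrix}\hat v\\ z\end{bmatrix}=\begin{bmatrix}b-J^Tu\\ u+\lambda\end{bmatrix},\qquad (z,\lambda)\in\mathcal S_c,$$ has a solution $(\hat v,z,\lambda)\in\mathbb R^n\times\mathbb R^{n_c}\times\mathbb R^{n_c}$. -/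

import Mathlib

namespace MultiContact

open scoped Matrix

/-- Complementarity `0 ≤ x ⊥ y ≥ 0` of two real numbers. -/
def Complementary (x y : ℝ) : Prop :=
  0 ≤ x ∧ 0 ≤ y ∧ x * y = 0

/-- Tangential part (first two coordinates) of a vector in a contact frame, with the Euclidean
norm of `ℝ²`. -/
def tangential (w : Fin 3 → ℝ) : EuclideanSpace ℝ (Fin 2) :=
  !₂[w 0, w 1]

/-- Normal part (third coordinate) of a vector in a contact frame. -/
def normal (w : Fin 3 → ℝ) : ℝ :=
  w 2

/-- Hard constraint with error `e`, between the constraint velocity `z` and the impulse `l`. -/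
def HardCondition (e z l : ℝ) : Prop :=
  Complementary l (z + e)

/-- Soft constraint with gain `k`, damping `b` and error `e`. -/
def SoftCondition (k b e z l : ℝ) : Prop :=
  l = -k * e - b * z

/-- Signorini–Coulomb condition with normal error `e` and friction coefficient `μ`, between the
contact velocity `z` and the contact impulse `l`; `δ` is the auxiliary variable. -/
def SignoriniCoulomb (e μ : ℝ) (z l : Fin 3 → ℝ) : Prop :=
  Complementary (normal l) (normal z + e) ∧
    ∃ δ : ℝ, Complementary δ (μ * normal l - ‖tangential l‖) ∧
      δ • tangential l + (μ * normal l) • tangential z = 0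

/-- Index of the scalar rows of the constraint space: one row for each of the `p` hard and the `s`
soft constraints, three rows for each of the `c` contacts. -/
abbrev Row (p s c : ℕ) : Type :=
  Fin p ⊕ Fin s ⊕ Fin c × Fin 3

/-- Parameters of `p` hard constraints, `s` soft constraints and `c` contacts. -/
structure Parameters (p s c : ℕ) where
  hardError : Fin p → ℝ
  softGain : Fin s → ℝ
  softDamping : Fin s → ℝ
  softError : Fin s → ℝ
  contactError : Fin c → ℝ
  friction : Fin c → ℝ

/-- The constraint set `𝒮_c` of all pairs `(z, l)` of constraint velocity and impulse that satisfy
every hard, soft and contact condition. -/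
def constraintSet {p s c : ℕ} (P : Parameters p s c) :
    Set ((Row p s c → ℝ) × (Row p s c → ℝ)) :=
  {x | (∀ i : Fin p,
          HardCondition (P.hardError i) (x.1 (Sum.inl i)) (x.2 (Sum.inl i))) ∧
       (∀ i : Fin s,
          SoftCondition (P.softGain i) (P.softDamping i) (P.softError i)
            (x.1 (Sum.inr (Sum.inl i))) (x.2 (Sum.inr (Sum.inl i)))) ∧
       (∀ i : Fin c,
          SignoriniCoulomb (P.contactError i) (P.friction i)
            (fun a => x.1 (Sum.inr (Sum.inr (i, a))))
            (fun a => x.2 (Sum.inr (Sum.inr (i, a)))))}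

/-- The matrix of the surrogate linear system in block form. -/
def surrogateMatrix {n p s c : ℕ} (A : Matrix (Fin n) (Fin n) ℝ)
    (J : Matrix (Row p s c) (Fin n) ℝ) (β : ℝ) :
    Matrix (Fin n ⊕ Row p s c) (Fin n ⊕ Row p s c) ℝ :=
  Matrix.fromBlocks (A + β • (Jᵀ * J)) (-(β • Jᵀ)) (-(β • J)) (β • 1)

/-- `(v, z, l)` solves the surrogate problem: the block linear system in `(v, z)`, coupled with
`(z, l) ∈ 𝒮_c`. -/
def IsSurrogateSolution {n p s c : ℕ} (P : Parameters p s c) (A : Matrix (Fin n) (Fin n) ℝ)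
    (b : Fin n → ℝ) (J : Matrix (Row p s c) (Fin n) ℝ) (β : ℝ) (u : Row p s c → ℝ)
    (v : Fin n → ℝ) (z l : Row p s c → ℝ) : Prop :=
  surrogateMatrix A J β *ᵥ Sum.elim v z = Sum.elim (b - Jᵀ *ᵥ u) (u + l) ∧
    (z, l) ∈ constraintSet P

end MultiContact

/-! Eliminating `v = A⁻¹ (b + Jᵀ l)` leaves `z = W l + q` with `W = β⁻¹ I + J A⁻¹ Jᵀ`, which is
strongly monotone because of `β⁻¹ I`, whatever the rank of `J`. Membership in `constraintSet`
follows from a variational inequality for `l` over a closed convex cone (half-lines, lines, friction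
cones), once `z` is shifted: by the errors, by `(k e + l) / b` on soft rows, and by De Saxcé's term
`μ ‖z_t‖` on contact normals (`mem_constraintSet_of_variationalInequality`).

De Saxcé's term destroys monotonicity, but it is continuous and pairs nonnegatively with admissible
impulses, so coercivity survives (`mul_impulseShift_nonneg`). Coercivity reduces the problem to a
compact convex set, where Brouwer's theorem applied to `x ↦ π (x - F x)` gives a solution. Brouwer's
theorem itself comes from a volume argument: the Jacobian integral of `x + t • (r x - x)` is
polynomial in `t` and equals the volume of the ball for small `t`, yet it would vanish at `t = 1`
for a retraction `r`. -/

/-! ### No `C¹` retraction of the ball onto the sphere. -/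

section Brouwer

open Set Metric MeasureTheory Polynomial

variable {E : Type*} [NormedAddCommGroup E] [InnerProductSpace ℝ E] [FiniteDimensional ℝ E]

/-- The determinant of `1 + t • M` is a polynomial in `t`. -/
theorem ContinuousLinearMap.exists_polynomial_det_one_add_smul (M : E →L[ℝ] E) :
    ∃ p : ℝ[X], p.natDegree ≤ Module.finrank ℝ E ∧
      ∀ t : ℝ, p.eval t = (ContinuousLinearMap.id ℝ E + t • M).det := by
  let b := Module.finBasis ℝ E
  let B := LinearMap.toMatrix b b (M : E →ₗ[ℝ] E)
  refine ⟨Matrix.det ((X : ℝ[X]) • B.map C + (1 : Matrix _ _ ℝ).map C), ?_, fun t => ?_⟩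
  · simpa using Polynomial.natDegree_det_X_add_C_le B 1
  · rw [ContinuousLinearMap.det, ← LinearMap.det_toMatrix b, ← Polynomial.coe_evalRingHom,
      RingHom.map_det]
    congr 1
    ext i j
    have h1 : LinearMap.toMatrix b b ((ContinuousLinearMap.id ℝ E + t • M : E →L[ℝ] E) :
        E →ₗ[ℝ] E) = 1 + t • B := by
      have h2 : ((ContinuousLinearMap.id ℝ E + t • M : E →L[ℝ] E) : E →ₗ[ℝ] E) =
          LinearMap.id + t • (M : E →ₗ[ℝ] E) := rfl
      rw [h2, map_add, map_smul, LinearMap.toMatrix_id]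
    rw [h1]
    simp only [Matrix.add_apply, Matrix.smul_apply, Matrix.map_apply, coe_evalRingHom,
      RingHom.mapMatrix_apply, smul_eq_mul, eval_add, eval_mul, eval_X, eval_C]
    ring

/-- A kernel vector satisfies `N x = -x`, so a nonzero one would contradict `‖N‖ < 1`. -/
theorem ContinuousLinearMap.det_one_add_ne_zero {N : E →L[ℝ] E} (hN : ‖N‖ < 1) :
    (ContinuousLinearMap.id ℝ E + N).det ≠ 0 := by
  intro h
  have hu : ¬ IsUnit ((ContinuousLinearMap.id ℝ E + N : E →L[ℝ] E) : E →ₗ[ℝ] E) := by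
    rw [LinearMap.isUnit_iff_isUnit_det]
    rw [ContinuousLinearMap.det] at h
    rw [h]
    simp
  rw [LinearMap.isUnit_iff_ker_eq_bot] at hu
  apply hu
  rw [LinearMap.ker_eq_bot']
  intro x hx
  have hx' : x + N x = 0 := by simpa using hx
  by_contra h0
  have : ‖N x‖ = ‖x‖ := by rw [eq_neg_of_add_eq_zero_right hx', norm_neg]
  have h1 := N.le_opNorm x
  have : 0 < ‖x‖ := norm_pos_iff.2 h0
  nlinarith

/-- Along the segment `t • N` the determinant starts at `1` and never vanishes. -/
theorem ContinuousLinearMap.det_one_add_pos {N : E →L[ℝ] E} (hN : ‖N‖ < 1) :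
    0 < (ContinuousLinearMap.id ℝ E + N).det := by
  by_contra! h
  have hc : Continuous fun t : ℝ => (ContinuousLinearMap.id ℝ E + t • N).det :=
    ContinuousLinearMap.continuous_det.comp (by fun_prop)
  obtain ⟨t, ht, h0⟩ : (0 : ℝ) ∈ (fun t : ℝ => (ContinuousLinearMap.id ℝ E + t • N).det) ''
      Icc 0 1 := by
    apply intermediate_value_Icc' zero_le_one hc.continuousOn
    refine ⟨by simpa using h, ?_⟩
    simp [ContinuousLinearMap.det]
  refine ContinuousLinearMap.det_one_add_ne_zero (N := t • N) ?_ h0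
  rw [norm_smul, Real.norm_of_nonneg ht.1]
  nlinarith [ht.1, ht.2, norm_nonneg N]

/-- If `g` vanishes on the unit sphere and is a small perturbation of zero in the `C¹` sense, then
`x ↦ x + t • g x` maps the unit ball bijectively to itself, so that its Jacobian integrates to the
volume of the ball. -/
theorem integral_det_one_add_smul_eq_volume_ball [MeasurableSpace E] [BorelSpace E]
    {g : E → E} {g' : E → E →L[ℝ] E} {K : NNReal} {t : ℝ}
    (hg : ∀ x ∈ ball (0 : E) 1, HasStrictFDerivAt g (g' x) x)
    (hcont : ContinuousOn g' (ball 0 1))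
    (hlip : LipschitzOnWith K g (closedBall 0 1))
    (hsphere : ∀ x ∈ sphere (0 : E) 1, g x = 0)
    (hmaps : ∀ x ∈ closedBall (0 : E) 1, x + t • g x ∈ closedBall (0 : E) 1)
    (ht : 0 ≤ t) (htK : t * K < 1) :
    ∫ x in ball (0 : E) 1, (ContinuousLinearMap.id ℝ E + t • g' x).det =
      (volume (ball (0 : E) 1)).toReal := by
  set f : E → E := fun x => x + t • g x with hf
  have hball : ball (0 : E) 1 ⊆ closedBall 0 1 := ball_subset_closedBall
  have hnorm : ∀ x ∈ ball (0 : E) 1, ‖t • g' x‖ < 1 := by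
    intro x hx
    have h1 : ‖g' x‖ ≤ K := (hg x hx).hasFDerivAt.le_of_lipschitzOn
      (Filter.mem_of_superset (isOpen_ball.mem_nhds hx) hball) hlip
    rw [norm_smul, Real.norm_of_nonneg ht]
    exact (mul_le_mul_of_nonneg_left h1 ht).trans_lt htK
  have hf' : ∀ x ∈ ball (0 : E) 1,
      HasStrictFDerivAt f (ContinuousLinearMap.id ℝ E + t • g' x) x := fun x hx =>
    (hasStrictFDerivAt_id x).add ((hg x hx).const_smul t)
  have hinj : InjOn f (closedBall 0 1) := by
    intro x hx y hy hxy
    by_contra hne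
    have h1 : x - y = t • (g y - g x) := by
      simp only [hf] at hxy
      rw [smul_sub, sub_eq_sub_iff_add_eq_add, hxy, add_comm]
    have h2 : ‖g y - g x‖ ≤ K * ‖x - y‖ := by
      rw [norm_sub_rev x y]; exact hlip.norm_sub_le hy hx
    have h3 : ‖x - y‖ = t * ‖g y - g x‖ := by
      conv_lhs => rw [h1]
      rw [norm_smul, Real.norm_of_nonneg ht]
    have h4 : 0 < ‖x - y‖ := norm_pos_iff.2 (sub_ne_zero.2 hne)
    nlinarith [mul_le_mul_of_nonneg_left h2 ht]
  have hopen : IsOpen (f '' ball 0 1) := by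
    rw [isOpen_iff_mem_nhds]
    rintro _ ⟨x, hx, rfl⟩
    rw [← (hf' x hx).map_nhds_eq_of_surj]
    · exact Filter.image_mem_map (isOpen_ball.mem_nhds hx)
    · have := ContinuousLinearMap.det_one_add_ne_zero (hnorm x hx)
      rw [ContinuousLinearMap.det, ← isUnit_iff_ne_zero, ← LinearMap.isUnit_iff_isUnit_det,
        LinearMap.isUnit_iff_range_eq_top] at this
      exact this
  have hsub : f '' ball 0 1 ⊆ ball 0 1 := by
    rw [← interior_closedBall (0 : E) one_ne_zero]
    refine interior_maximal ?_ (by rwa [interior_closedBall (0 : E) one_ne_zero])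
    rintro _ ⟨x, hx, rfl⟩
    exact hmaps x (interior_subset hx)
  -- The image is open, and relatively closed in the ball because `f` fixes the sphere;
  -- connectedness of the ball does the rest.
  have himage : f '' ball 0 1 = ball 0 1 := by
    apply Subset.antisymm hsub
    · apply (convex_ball (0 : E) 1).isPreconnected.subset_of_closure_inter_subset hopen
      · have h0 : (0 : E) ∈ ball (0 : E) 1 := mem_ball_self one_pos
        refine ⟨f 0, ?_, mem_image_of_mem f h0⟩
        exact hsub (mem_image_of_mem f h0)
      · have hfc : ContinuousOn f (closedBall 0 1) :=
          continuousOn_id.add (hlip.continuousOn.const_smul t)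
        have hcl : closure (f '' ball 0 1) ⊆ f '' closedBall 0 1 :=
          closure_minimal (image_mono hball)
            ((isCompact_closedBall (0 : E) 1).image_of_continuousOn hfc).isClosed
        rintro y ⟨hy, hyb⟩
        obtain ⟨x, hx, rfl⟩ := hcl hy
        refine mem_image_of_mem f ?_
        by_contra hxb
        have hxs : x ∈ sphere (0 : E) 1 := by
          rw [← closedBall_sdiff_ball]; exact ⟨hx, hxb⟩
        apply hxb
        simpa [hf, hsphere x hxs] using hyb
  have hpos : ∀ x ∈ ball (0 : E) 1, 0 < (ContinuousLinearMap.id ℝ E + t • g' x).det :=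
    fun x hx => ContinuousLinearMap.det_one_add_pos (hnorm x hx)
  have hmeas : ContinuousOn (fun x => (ContinuousLinearMap.id ℝ E + t • g' x).det) (ball 0 1) :=
    ContinuousLinearMap.continuous_det.comp_continuousOn
      (continuousOn_const.add (hcont.const_smul t))
  rw [integral_eq_lintegral_of_nonneg_ae]
  · congr 1
    conv_rhs => rw [← himage]
    rw [← lintegral_abs_det_fderiv_eq_addHaar_image volume measurableSet_ball
      (fun x hx => (hf' x hx).hasFDerivAt.hasFDerivWithinAt) (hinj.mono hball)]
    refine setLIntegral_congr_fun measurableSet_ball fun x hx => ?_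
    rw [abs_of_pos (hpos x hx)]
  · exact (ae_restrict_mem measurableSet_ball).mono fun x hx => (hpos x hx).le
  · exact hmeas.aestronglyMeasurable measurableSet_ball

/-- There is no `C¹` retraction of the closed unit ball onto the unit sphere. -/
theorem not_exists_contDiffOn_retraction {r : E → E} {U : Set E} (hU : IsOpen U)
    (hBU : closedBall (0 : E) 1 ⊆ U) (hr : ContDiffOn ℝ 1 r U)
    (hnorm : ∀ x ∈ closedBall (0 : E) 1, ‖r x‖ = 1)
    (hfix : ∀ x ∈ sphere (0 : E) 1, r x = x) : False := by
  borelize E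
  set g : E → E := fun x => r x - x with hgdef
  have hball : ball (0 : E) 1 ⊆ closedBall 0 1 := ball_subset_closedBall
  have hgU : ContDiffOn ℝ 1 g U := hr.sub contDiffOn_id
  have hg : ∀ x ∈ closedBall (0 : E) 1, HasStrictFDerivAt g (fderiv ℝ g x) x := fun x hx =>
    (hgU.contDiffAt (hU.mem_nhds (hBU hx))).hasStrictFDerivAt one_ne_zero
  have hcont : ContinuousOn (fderiv ℝ g) (closedBall 0 1) :=
    (hgU.continuousOn_fderiv_of_isOpen hU le_rfl).mono hBU
  obtain ⟨K, hK⟩ := (hgU.mono hBU).exists_lipschitzOnWith one_ne_zero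
    (convex_closedBall (0 : E) 1) (isCompact_closedBall 0 1)
  have hsphere : ∀ x ∈ sphere (0 : E) 1, g x = 0 := fun x hx => by simp [hgdef, hfix x hx]
  have hmaps : ∀ t ∈ Icc (0 : ℝ) 1, ∀ x ∈ closedBall (0 : E) 1,
      x + t • g x ∈ closedBall (0 : E) 1 := by
    intro t ht x hx
    refine (convex_closedBall (0 : E) 1).add_smul_mem hx ?_ ht
    simp [hgdef, hnorm x hx]
  set D : ℝ → E → ℝ := fun t x => (ContinuousLinearMap.id ℝ E + t • fderiv ℝ g x).det with hD
  have hint : ∀ t, IntegrableOn (D t) (ball 0 1) := fun t =>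
    ((ContinuousLinearMap.continuous_det.comp_continuousOn
      (continuousOn_const.add (hcont.const_smul t))).integrableOn_compact
        (isCompact_closedBall 0 1)).mono_set hball
  -- interpolation nodes
  set d := Module.finrank ℝ E
  set ν : ℕ → ℝ := fun j => 1 / ((j + 1 : ℝ) * (K + 1)) with hν
  have hνinj : Function.Injective ν := by
    intro i j hij
    have hK1 : (0 : ℝ) < K + 1 := by positivity
    simp only [hν, one_div, inv_inj] at hij
    have := mul_right_cancel₀ hK1.ne' hij
    exact_mod_cast add_right_cancel this
  have hν0 : ∀ j, 0 ≤ ν j := fun j => by positivity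
  -- Yields both `ν j ≤ 1`, so that the ball is preserved, and `ν j * K < 1`, so that the map is
  -- injective.
  have hνK : ∀ j, ν j * (K + 1) ≤ 1 := by
    intro j
    have hK1 : (0 : ℝ) < K + 1 := by positivity
    have : ν j * (K + 1) = 1 / (j + 1 : ℝ) := by simp only [hν]; field_simp
    rw [this, div_le_one (by positivity)]
    linarith [(Nat.cast_nonneg j : (0 : ℝ) ≤ j)]
  have hνpos : ∀ j, 0 < ν j := fun j => by positivity
  have hvol : ∀ j, ∫ x in ball (0 : E) 1, D (ν j) x = (volume (ball (0 : E) 1)).toReal := by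
    intro j
    refine integral_det_one_add_smul_eq_volume_ball (fun x hx => hg x (hball hx))
      (hcont.mono hball) hK hsphere (hmaps _ ⟨hν0 j, ?_⟩) (hν0 j) ?_
    · nlinarith [hνK j, hν0 j, K.2, mul_nonneg (hν0 j) K.2]
    · linarith [hνK j, hνpos j]
  set s := Finset.range (d + 1)
  set L : ℕ → ℝ := fun j => (Lagrange.basis s ν j).eval 1
  -- Degree at most `d` and `d + 1` nodes: the value at `1` is a combination of the nodal values
  -- with weights independent of `x`, so it can be integrated.
  have hinterp : ∀ x, D 1 x = ∑ j ∈ s, D (ν j) x * L j := by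
    intro x
    obtain ⟨p, hp, hpe⟩ := ContinuousLinearMap.exists_polynomial_det_one_add_smul (fderiv ℝ g x)
    have hdeg : p.degree < s.card := by
      rw [Finset.card_range]
      exact (Polynomial.degree_le_of_natDegree_le hp).trans_lt (by exact_mod_cast Nat.lt_succ_self d)
    have := congrArg (Polynomial.eval 1) (Lagrange.eq_interpolate (hνinj.injOn (s := s)) hdeg)
    rw [hpe, Lagrange.interpolate_apply, Polynomial.eval_finsetSum] at this
    simpa only [hpe, eval_mul, eval_C] using this
  have hsumL : ∑ j ∈ s, L j = 1 := by
    have := Lagrange.sum_basis (hνinj.injOn (s := s)) ⟨0, by simp [s]⟩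
    simpa [Polynomial.eval_finsetSum] using congrArg (Polynomial.eval 1) this
  have hone : ∫ x in ball (0 : E) 1, D 1 x = (volume (ball (0 : E) 1)).toReal := by
    simp_rw [hinterp]
    rw [integral_finsetSum _ fun j _ => (hint (ν j)).mul_const _]
    simp_rw [integral_mul_const, hvol, ← Finset.mul_sum, hsumL, mul_one]
  -- Since `‖r‖ ^ 2` is constant, the derivative of `r` takes values orthogonal to `r x`; if
  -- invertible, it would attain `r x` itself, which has norm `1`.
  have hzero : ∀ x ∈ ball (0 : E) 1, D 1 x = 0 := by
    intro x hx
    by_contra hne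
    have hrd : HasFDerivAt r (ContinuousLinearMap.id ℝ E + (1 : ℝ) • fderiv ℝ g x) x := by
      have := (hasFDerivAt_id x).add (hg x (hball hx)).hasFDerivAt
      rw [one_smul]
      refine this.congr_of_eventuallyEq (Filter.Eventually.of_forall fun y => ?_)
      simp [hgdef]
    have h1 : HasFDerivAt (fun y => ‖r y‖ ^ 2) (2 • (innerSL ℝ (r x)).comp
      (ContinuousLinearMap.id ℝ E + (1 : ℝ) • fderiv ℝ g x)) x := hrd.norm_sq
    have h2 : HasFDerivAt (fun y => ‖r y‖ ^ 2) (0 : E →L[ℝ] ℝ) x := by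
      refine (hasFDerivAt_const (1 : ℝ) x).congr_of_eventuallyEq ?_
      filter_upwards [isOpen_ball.mem_nhds hx] with y hy
      simp [hnorm y (hball hy)]
    have h3 := h1.unique h2
    change ¬(ContinuousLinearMap.id ℝ E + (1 : ℝ) • fderiv ℝ g x).det = 0 at hne
    rw [ContinuousLinearMap.det, ← ne_eq, ← isUnit_iff_ne_zero, ← LinearMap.isUnit_iff_isUnit_det,
        LinearMap.isUnit_iff_range_eq_top, LinearMap.range_eq_top] at hne
    obtain ⟨v, hv⟩ := hne (r x)
    have h4 := DFunLike.congr_fun h3 v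
    have h5 : inner ℝ (r x) (r x) = (0 : ℝ) := by
      have h6 : (2 : ℕ) • inner ℝ (r x)
          ((ContinuousLinearMap.id ℝ E + (1 : ℝ) • fderiv ℝ g x) v) = (0 : ℝ) := h4
      rw [show (ContinuousLinearMap.id ℝ E + (1 : ℝ) • fderiv ℝ g x) v = r x from hv] at h6
      simpa using h6
    rw [real_inner_self_eq_norm_sq, hnorm x (hball hx)] at h5
    norm_num at h5
  rw [setIntegral_congr_fun measurableSet_ball hzero, integral_zero] at hone
  have := (measure_ball_pos volume (0 : E) one_pos).ne'
  have h' := (measure_ball_lt_top (μ := volume) (x := (0 : E)) (r := 1)).ne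
  rcases (ENNReal.toReal_eq_zero_iff _).1 hone.symm with h | h
  · exact this h
  · exact h' h

end Brouwer
-- Brouwer's theorem and variational inequalities.
section FixedPoint

open Set Metric

variable {E : Type*} [NormedAddCommGroup E] [InnerProductSpace ℝ E] [FiniteDimensional ℝ E]

/-- A `C¹` map sending the closed unit ball into the open unit ball has a fixed point. -/
theorem exists_fixedPoint_closedBall_one_of_contDiff {p : E → E} (hp : ContDiff ℝ 1 p)
    (hmaps : ∀ x ∈ closedBall (0 : E) 1, ‖p x‖ < 1) : ∃ x ∈ closedBall (0 : E) 1, p x = x := by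
  by_contra! hne
  set d : E → E := fun x => x - p x with hd
  set a : E → ℝ := fun x => ‖d x‖ ^ 2 with ha
  set b : E → ℝ := fun x => inner ℝ x (d x) with hb
  -- A quarter of the discriminant of `‖x + τ • d x‖ ^ 2 = 1` as a quadratic in `τ`. The larger root
  -- gives the retraction; on the sphere `b > 0`, so `√q = b` and `τ = 0`.
  set q : E → ℝ := fun x => b x ^ 2 + a x * (1 - ‖x‖ ^ 2) with hq
  have hdc : ContDiff ℝ 1 d := contDiff_id.sub hp
  have hac : ContDiff ℝ 1 a := hdc.norm_sq ℝ
  have hbc : ContDiff ℝ 1 b := contDiff_id.inner ℝ hdc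
  have hqc : ContDiff ℝ 1 q :=
    (hbc.pow 2).add (hac.mul (contDiff_const.sub (contDiff_id.norm_sq ℝ)))
  have hapos : ∀ x ∈ closedBall (0 : E) 1, 0 < a x := fun x hx =>
    pow_pos (norm_pos_iff.2 (sub_ne_zero.2 (hne x hx).symm)) 2
  have hbpos : ∀ x ∈ sphere (0 : E) 1, 0 < b x := by
    intro x hx
    have hx1 : ‖x‖ = 1 := by simpa using hx
    have h1 : inner ℝ x (p x) ≤ ‖x‖ * ‖p x‖ := real_inner_le_norm x (p x)
    have h2 := hmaps x (sphere_subset_closedBall hx)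
    simp only [hb, hd, inner_sub_right, real_inner_self_eq_norm_sq, hx1] at h1 ⊢
    linarith
  have hqsphere : ∀ x ∈ sphere (0 : E) 1, q x = b x ^ 2 := by
    intro x hx
    have hx1 : ‖x‖ = 1 := by simpa using hx
    simp [hq, hx1]
  have hqpos : ∀ x ∈ closedBall (0 : E) 1, 0 < q x := by
    intro x hx
    by_cases hs : x ∈ sphere (0 : E) 1
    · rw [hqsphere x hs]; exact pow_pos (hbpos x hs) 2
    · have hx1 : ‖x‖ < 1 := lt_of_le_of_ne (by simpa using hx) (by simpa using hs)
      have h1 : 0 < 1 - ‖x‖ ^ 2 := by nlinarith [norm_nonneg x]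
      have := mul_pos (hapos x hx) h1
      simp only [hq]
      positivity
  refine not_exists_contDiffOn_retraction
    (r := fun x => x + ((-b x + √(q x)) / a x) • d x) (U := {x | 0 < q x} ∩ {x | 0 < a x})
    ((isOpen_lt continuous_const hqc.continuous).inter (isOpen_lt continuous_const hac.continuous))
    (fun x hx => ⟨hqpos x hx, hapos x hx⟩) ?_ ?_ ?_
  · refine contDiffOn_id.add (ContDiffOn.smul (ContDiffOn.div
      (hbc.neg.contDiffOn.add (hqc.contDiffOn.sqrt fun x hx => hx.1.ne')) hac.contDiffOn
        fun x hx => hx.2.ne') hdc.contDiffOn)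
  · intro x hx
    have h1 := hapos x hx
    have h2 := Real.sq_sqrt (hqpos x hx).le
    have h3 : ‖x + ((-b x + √(q x)) / a x) • d x‖ ^ 2 = 1 := by
      rw [norm_add_sq_real, norm_smul, inner_smul_right, mul_pow, Real.norm_eq_abs, sq_abs]
      change ‖x‖ ^ 2 + 2 * ((-b x + √(q x)) / a x * b x) +
        ((-b x + √(q x)) / a x) ^ 2 * a x = 1
      field_simp
      have h4 : q x = b x ^ 2 + a x * (1 - ‖x‖ ^ 2) := rfl
      nlinarith
    exact (pow_eq_one_iff_of_nonneg (norm_nonneg _) two_ne_zero).1 h3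
  · intro x hx
    rw [hqsphere x hx, Real.sqrt_sq (hbpos x hx).le]
    simp

/-- Brouwer's fixed point theorem for the closed unit ball. -/
theorem exists_fixedPoint_closedBall_one {f : E → E} (hf : Continuous f)
    (hmaps : MapsTo f (closedBall 0 1) (closedBall 0 1)) :
    ∃ x ∈ closedBall (0 : E) 1, f x = x := by
  by_contra! hne
  obtain ⟨y, hy, hmin⟩ := (isCompact_closedBall (0 : E) 1).exists_isMinOn
    ⟨0, mem_closedBall_self zero_le_one⟩ (hf.sub continuous_id).norm.continuousOn
  -- Half the least displacement of `f`: a fixed point of the rescaled `ε`-approximation would be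
  -- displaced by less than `2 * ε`.
  set ε : ℝ := ‖f y - y‖ / 2 with hε
  have hεpos : 0 < ε := half_pos (norm_pos_iff.2 (sub_ne_zero.2 (hne y hy)))
  obtain ⟨g, hg, hgf, -⟩ := hf.exists_contDiff_approx 1 (ε := fun _ => ε) continuous_const
    fun _ => hεpos
  have hp1 : ∀ x ∈ closedBall (0 : E) 1, ‖(1 + ε)⁻¹ • g x‖ < 1 := by
    intro x hx
    have h1 : ‖f x‖ ≤ 1 := by simpa using hmaps hx
    have h2 : ‖g x - f x‖ < ε := by simpa [dist_eq_norm] using hgf x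
    have h3 : ‖g x‖ ≤ ‖g x - f x‖ + ‖f x‖ := by simpa using norm_add_le (g x - f x) (f x)
    rw [norm_smul, Real.norm_of_nonneg (by positivity), inv_mul_lt_one₀ (by positivity)]
    linarith
  obtain ⟨x, hx, hfix⟩ := exists_fixedPoint_closedBall_one_of_contDiff
    (contDiff_const.smul hg : ContDiff ℝ 1 fun x => (1 + ε)⁻¹ • g x) hp1
  have hgx : g x = x + ε • x := by
    have : (1 + ε) • ((1 + ε)⁻¹ • g x) = (1 + ε) • x := congrArg _ hfix
    rwa [smul_inv_smul₀ (by positivity), add_smul, one_smul] at this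
  have h1 : 2 * ε ≤ ‖f x - x‖ := by
    have := hmin hx
    simp only [hε]
    linarith [show ‖f y - y‖ ≤ ‖f x - x‖ from this]
  have h2 : ‖g x - f x‖ < ε := by simpa [dist_eq_norm] using hgf x
  have h3 : f x - x = ε • x - (g x - f x) := by rw [hgx]; abel
  have h4 : ‖ε • x‖ ≤ ε := by
    rw [norm_smul, Real.norm_of_nonneg hεpos.le]
    have : ‖x‖ ≤ 1 := by simpa using hx
    nlinarith
  have h5 := norm_sub_le (ε • x) (g x - f x)
  rw [← h3] at h5
  linarith

/-- Brouwer's fixed point theorem for a closed ball centred at the origin. -/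
theorem exists_fixedPoint_closedBall {f : E → E} (hf : Continuous f) {R : ℝ}
    (hR : 0 < R) (hmaps : MapsTo f (closedBall 0 R) (closedBall 0 R)) :
    ∃ x ∈ closedBall (0 : E) R, f x = x := by
  have hscale : ∀ x ∈ closedBall (0 : E) 1, R • x ∈ closedBall (0 : E) R := by
    intro x hx
    have : ‖x‖ ≤ 1 := by simpa using hx
    rw [mem_closedBall_zero_iff, norm_smul, Real.norm_of_nonneg hR.le]
    nlinarith
  obtain ⟨x, hx, hfix⟩ := exists_fixedPoint_closedBall_one
    (f := fun x => R⁻¹ • f (R • x)) (by fun_prop) fun x hx => by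
      have h1 : ‖f (R • x)‖ ≤ R := by simpa using hmaps (hscale x hx)
      rw [mem_closedBall_zero_iff, norm_smul, Real.norm_of_nonneg (by positivity),
        inv_mul_le_one₀ hR]
      exact h1
  refine ⟨R • x, hscale x hx, ?_⟩
  have : R • (R⁻¹ • f (R • x)) = R • x := congrArg _ hfix
  rwa [smul_inv_smul₀ hR.ne'] at this

/-- The Hartman–Stampacchia theorem: a continuous variational inequality on a nonempty compact
convex set has a solution. -/
theorem exists_variationalInequality_of_isCompact {C : Set E} (hC : IsCompact C)
    (hconv : Convex ℝ C) (hne : C.Nonempty) {F : E → E} (hF : Continuous F) :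
    ∃ x ∈ C, ∀ y ∈ C, 0 ≤ inner ℝ (F x) (y - x) := by
  have hproj : ∀ u : E, ∃ v ∈ C, ∀ w ∈ C, inner ℝ (u - v) (w - v) ≤ 0 := by
    intro u
    obtain ⟨v, hv, hmin⟩ := exists_norm_eq_iInf_of_complete_convex hne hC.isComplete hconv u
    exact ⟨v, hv, (norm_eq_iInf_iff_real_inner_le_zero hconv hv).1 hmin⟩
  choose π hπC hπ using hproj
  have hlip : LipschitzWith 1 π := by
    refine LipschitzWith.of_dist_le_mul fun u w => ?_
    rw [NNReal.coe_one, one_mul, dist_eq_norm, dist_eq_norm]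
    have h1 := hπ u (π w) (hπC w)
    have h2 := hπ w (π u) (hπC u)
    -- Sum of the two projection inequalities: `π` is firmly nonexpansive.
    have h3 : ‖π u - π w‖ ^ 2 ≤ inner ℝ (u - w) (π u - π w) := by
      rw [← real_inner_self_eq_norm_sq]
      simp only [inner_sub_left, inner_sub_right] at h1 h2 ⊢
      linarith
    have h4 := real_inner_le_norm (u - w) (π u - π w)
    by_contra! h5
    nlinarith [norm_nonneg (u - w)]
  obtain ⟨R, hR, hCR⟩ := hC.isBounded.exists_pos_norm_le
  obtain ⟨x, -, hx⟩ := exists_fixedPoint_closedBall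
    (hlip.continuous.comp (continuous_id.sub hF)) hR
    fun x _ => by simpa using hCR _ (hπC (x - F x))
  simp only [Function.comp_apply, Pi.sub_apply, id_eq] at hx
  refine ⟨x, hx ▸ hπC _, fun y hy => ?_⟩
  have := hπ (x - F x) y hy
  rw [hx] at this
  simpa using this

/-- A continuous variational inequality on a closed convex set containing the origin has a solution
when the operator is coercive. -/
theorem exists_variationalInequality_of_coercive {C : Set E} (hC : IsClosed C)
    (hconv : Convex ℝ C) (h0 : (0 : E) ∈ C) {F : E → E} (hF : Continuous F) {R : ℝ}
    (hcoer : ∀ x ∈ C, R ≤ ‖x‖ → 0 < inner ℝ (F x) x) :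
    ∃ x ∈ C, ∀ y ∈ C, 0 ≤ inner ℝ (F x) (y - x) := by
  set S := max R 0
  obtain ⟨x, ⟨hxC, hxS⟩, hx⟩ := exists_variationalInequality_of_isCompact
    ((isCompact_closedBall (0 : E) S).inter_left hC) (hconv.inter (convex_closedBall 0 S))
    ⟨0, h0, by simp [S]⟩ hF
  -- Testing with `0` keeps `x` off the boundary of the truncating ball, so short steps towards any
  -- `y ∈ C` remain admissible.
  have hlt : ‖x‖ < S := by
    by_contra! h
    have h1 := hcoer x hxC ((le_max_left R 0).trans h)
    have h2 := hx 0 ⟨h0, by simp [S]⟩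
    simp at h2
    linarith
  refine ⟨x, hxC, fun y hy => ?_⟩
  have hcont : Filter.Tendsto (fun t : ℝ => ‖x + t • (y - x)‖) (nhds 0) (nhds ‖x‖) := by
    have : Continuous fun t : ℝ => ‖x + t • (y - x)‖ := by fun_prop
    simpa using this.tendsto 0
  obtain ⟨t, htS, ht0, ht1⟩ := ((hcont.eventually_lt_const hlt).filter_mono
    nhdsWithin_le_nhds |>.and (Ioc_mem_nhdsGT one_pos)).exists
  have := hx (x + t • (y - x))
    ⟨hconv.add_smul_sub_mem hxC hy ⟨ht0.le, ht1⟩, by simpa using htS.le⟩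
  rw [add_sub_cancel_left, inner_smul_right] at this
  exact nonneg_of_mul_nonneg_right this ht0

end FixedPoint

section Solve

open Matrix

/-- A strongly monotone affine operator, perturbed by a continuous term that does not oppose its
argument, has a solution of the variational inequality over a closed convex set containing zero. -/
theorem exists_variationalInequality_mulVec_add {ι : Type*} [Fintype ι] {C : Set (ι → ℝ)}
    (hC : IsClosed C) (hconv : Convex ℝ C) (h0 : (0 : ι → ℝ) ∈ C) {W : Matrix ι ι ℝ} {α : ℝ}
    (hα : 0 < α) (hW : ∀ x : ι → ℝ, α * (x ⬝ᵥ x) ≤ x ⬝ᵥ W *ᵥ x) (q : ι → ℝ)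
    {ρ : (ι → ℝ) → ι → ℝ} (hρ : Continuous ρ) (hρC : ∀ x ∈ C, ∀ i, 0 ≤ x i * ρ x i) :
    ∃ x ∈ C, ∀ y ∈ C, 0 ≤ (W *ᵥ x + q + ρ x) ⬝ᵥ (y - x) := by
  set F : EuclideanSpace ℝ ι → EuclideanSpace ℝ ι := fun x =>
    WithLp.toLp 2 (W *ᵥ x.ofLp + q + ρ x.ofLp) with hF
  have hinner : ∀ x y : EuclideanSpace ℝ ι, inner ℝ x y = x.ofLp ⬝ᵥ y.ofLp := by
    intro x y
    simp [PiLp.inner_apply, dotProduct, mul_comm]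
  have hFc : Continuous F := by
    have h1 := PiLp.continuous_ofLp 2 (fun _ : ι => ℝ)
    exact (PiLp.continuous_toLp 2 (fun _ : ι => ℝ)).comp
      (((Continuous.matrix_mulVec continuous_const h1).add continuous_const).add (hρ.comp h1))
  obtain ⟨x, hx, hVI⟩ := exists_variationalInequality_of_coercive
    (C := WithLp.ofLp ⁻¹' C) (hC.preimage (PiLp.continuous_ofLp 2 _))
    (fun x hx y hy a b ha hb hab => hconv hx hy ha hb hab) h0 hFc
    -- Beyond this radius `α * ‖x‖ ^ 2` exceeds `‖q‖ * ‖x‖` by at least `α * ‖x‖ > 0`.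
    (R := ‖WithLp.toLp 2 q‖ / α + 1) (by
      intro x hx hR
      have h1 : inner ℝ (F x) x =
          x.ofLp ⬝ᵥ W *ᵥ x.ofLp + inner ℝ (WithLp.toLp 2 q) x + x.ofLp ⬝ᵥ ρ x.ofLp := by
        rw [hinner, hinner]
        simp only [hF, add_dotProduct]
        rw [dotProduct_comm x.ofLp, dotProduct_comm x.ofLp]
      have h2 : 0 ≤ x.ofLp ⬝ᵥ ρ x.ofLp := Finset.sum_nonneg fun i _ => hρC _ hx i
      have h3 : α * ‖x‖ ^ 2 ≤ x.ofLp ⬝ᵥ W *ᵥ x.ofLp := by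
        rw [← real_inner_self_eq_norm_sq, hinner]
        exact hW _
      have h4 := neg_le_of_abs_le (abs_real_inner_le_norm (WithLp.toLp 2 q) x)
      have h5 : ‖WithLp.toLp 2 q‖ + α ≤ α * ‖x‖ := by
        have := mul_le_mul_of_nonneg_left hR hα.le
        rwa [mul_add, mul_div_cancel₀ _ hα.ne', mul_one] at this
      have h6 : 0 < ‖x‖ := lt_of_lt_of_le (by positivity) hR
      rw [h1]
      nlinarith)
  refine ⟨x.ofLp, hx, fun y hy => ?_⟩
  have := hVI (WithLp.toLp 2 y) hy
  rwa [hinner] at this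

namespace MultiContact

/-! ### The friction cone and De Saxcé's reformulation. -/

/-- The Coulomb friction cone of a contact with friction coefficient `μ`. -/
def frictionCone (μ : ℝ) : Set (Fin 3 → ℝ) :=
  {w | 0 ≤ normal w ∧ ‖tangential w‖ ≤ μ * normal w}

theorem continuous_tangential : Continuous tangential :=
  (PiLp.continuous_toLp 2 _).comp (by
    refine continuous_pi fun i => ?_
    fin_cases i
    · exact continuous_apply 0
    · exact continuous_apply 1)

theorem continuous_normal : Continuous normal := continuous_apply 2

theorem tangential_add (v w : Fin 3 → ℝ) : tangential (v + w) = tangential v + tangential w := by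
  ext i; fin_cases i <;> simp [tangential]

theorem tangential_smul (a : ℝ) (w : Fin 3 → ℝ) : tangential (a • w) = a • tangential w := by
  ext i; fin_cases i <;> simp [tangential]

theorem tangential_zero : tangential 0 = 0 := by
  ext i; fin_cases i <;> simp [tangential]

theorem isClosed_frictionCone (μ : ℝ) : IsClosed (frictionCone μ) :=
  (isClosed_le continuous_const continuous_normal).inter
    (isClosed_le continuous_tangential.norm (continuous_normal.const_mul μ))

theorem zero_mem_frictionCone (μ : ℝ) : (0 : Fin 3 → ℝ) ∈ frictionCone μ := by
  simp [frictionCone, tangential_zero, normal]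

theorem smul_mem_frictionCone {μ a : ℝ} (ha : 0 ≤ a) {w : Fin 3 → ℝ} (hw : w ∈ frictionCone μ) :
    a • w ∈ frictionCone μ := by
  refine ⟨mul_nonneg ha hw.1, ?_⟩
  rw [tangential_smul, norm_smul, Real.norm_of_nonneg ha]
  calc a * ‖tangential w‖ ≤ a * (μ * normal w) := mul_le_mul_of_nonneg_left hw.2 ha
    _ = μ * normal (a • w) := by simp [normal]; ring

theorem add_mem_frictionCone {μ : ℝ} {v w : Fin 3 → ℝ} (hv : v ∈ frictionCone μ)
    (hw : w ∈ frictionCone μ) : v + w ∈ frictionCone μ := by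
  refine ⟨add_nonneg hv.1 hw.1, ?_⟩
  rw [tangential_add]
  calc ‖tangential v + tangential w‖ ≤ ‖tangential v‖ + ‖tangential w‖ := norm_add_le _ _
    _ ≤ μ * normal v + μ * normal w := add_le_add hv.2 hw.2
    _ = μ * normal (v + w) := by simp [normal]; ring

theorem convex_frictionCone (μ : ℝ) : Convex ℝ (frictionCone μ) :=
  fun _ hv _ hw _ _ ha hb _ =>
    add_mem_frictionCone (smul_mem_frictionCone ha hv) (smul_mem_frictionCone hb hw)

/-- De Saxcé's formulation: the variational inequality over the friction cone for the velocity
whose normal part is increased by `e + μ * ‖z_t‖` implies the Signorini–Coulomb condition. -/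
theorem signoriniCoulomb_of_variationalInequality {e μ : ℝ} (hμ : 0 ≤ μ) {z l : Fin 3 → ℝ}
    (hl : l ∈ frictionCone μ)
    (hVI : ∀ y ∈ frictionCone μ, 0 ≤ inner ℝ (tangential z) (tangential y - tangential l) +
      (normal z + e + μ * ‖tangential z‖) * (normal y - normal l)) :
    SignoriniCoulomb e μ z l := by
  obtain ⟨hn, ht⟩ := hl
  set Z := tangential z
  set T := tangential l with hT
  set N := normal l with hN
  -- On a cone, testing with `0` and `2 • l` forces the pairing with `l` to vanish.
  have hzero : inner ℝ Z T + (normal z + e + μ * ‖Z‖) * N = 0 := by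
    have h1 := hVI 0 (zero_mem_frictionCone μ)
    have h2 := hVI ((2 : ℝ) • l) (smul_mem_frictionCone zero_le_two ⟨hn, ht⟩)
    rw [tangential_smul, ← hT, two_smul, add_sub_cancel_right,
      show normal ((2 : ℝ) • l) = 2 * N from rfl] at h2
    rw [tangential_zero, zero_sub, inner_neg_right, show normal 0 = 0 from rfl] at h1
    linarith
  -- The test vector has unit normal part and tangential part of norm `μ` opposite to `Z`, so its
  -- tangential pairing cancels the shift `μ * ‖Z‖`. For `Z = 0` the cone axis suffices.
  have hgap : 0 ≤ normal z + e := by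
    by_cases hZ : Z = 0
    · have h2 : tangential ![0, 0, 1] = 0 := by ext i; fin_cases i <;> simp [tangential]
      have h1 := hVI ![0, 0, 1] ⟨by simp [normal], by rw [h2]; simp [normal, hμ]⟩
      rw [show normal ![0, 0, 1] = 1 from rfl] at h1
      simp only [hZ, inner_zero_left, norm_zero, mul_zero, add_zero, zero_add] at h1 hzero
      linarith
    · have hZ' : ‖Z‖ ≠ 0 := norm_ne_zero_iff.2 hZ
      have h2 : tangential ![-(μ / ‖Z‖) * z 0, -(μ / ‖Z‖) * z 1, 1] = -(μ / ‖Z‖) • Z := by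
        ext i; fin_cases i <;> simp [tangential, Z]
      have h1 := hVI ![-(μ / ‖Z‖) * z 0, -(μ / ‖Z‖) * z 1, 1] ⟨by simp [normal], by
        rw [h2, norm_smul, norm_neg, Real.norm_of_nonneg (by positivity)]
        simp [normal, hZ']⟩
      rw [h2, inner_sub_right, inner_smul_right, real_inner_self_eq_norm_sq,
        show -(μ / ‖Z‖) * ‖Z‖ ^ 2 = -(μ * ‖Z‖) by field_simp,
        show normal ![-(μ / ‖Z‖) * z 0, -(μ / ‖Z‖) * z 1, 1] = 1 from rfl] at h1
      linarith
  -- The vanishing pairing is the sum of `inner ℝ Z T + ‖Z‖ * ‖T‖`, `‖Z‖ * (μ * N - ‖T‖)` and `N *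
  -- (normal z + e)`, all nonnegative; hence each is zero. The sliding speed `‖Z‖` serves as `δ`.
  have hcs : -(‖Z‖ * ‖T‖) ≤ inner ℝ Z T := neg_le_of_abs_le (abs_real_inner_le_norm Z T)
  have hs : 0 ≤ ‖Z‖ * (μ * N - ‖T‖) := mul_nonneg (norm_nonneg _) (sub_nonneg.2 ht)
  have hNg : 0 ≤ N * (normal z + e) := mul_nonneg hn hgap
  have hcomp : N * (normal z + e) = 0 := by nlinarith
  have hslip : ‖Z‖ * (μ * N - ‖T‖) = 0 := by nlinarith
  have hin : inner ℝ Z T = -(‖Z‖ * ‖T‖) := by nlinarith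
  refine ⟨⟨hn, hgap, hcomp⟩, ‖Z‖, ⟨norm_nonneg _, sub_nonneg.2 ht, hslip⟩, ?_⟩
  rcases mul_eq_zero.1 hslip with h | h
  · rw [h, zero_smul, zero_add, show tangential z = 0 from norm_eq_zero.1 h, smul_zero]
  -- Equality in Cauchy–Schwarz makes the squared norm of `‖Z‖ • T + ‖T‖ • Z` zero.
  · rw [sub_eq_zero.1 h, ← norm_eq_zero, ← sq_eq_zero_iff, norm_add_sq_real, norm_smul, norm_smul,
      inner_smul_left, inner_smul_right, real_inner_comm, hin]
    simp
    ring

/-! ### The full constraint space as a variational inequality. -/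

variable {p s c : ℕ}

/-- The part of a constraint vector that belongs to the contact `i`. -/
def contactBlock (i : Fin c) (x : Row p s c → ℝ) : Fin 3 → ℝ :=
  fun a => x (Sum.inr (Sum.inr (i, a)))

theorem continuous_contactBlock (i : Fin c) :
    Continuous (contactBlock i : (Row p s c → ℝ) → Fin 3 → ℝ) :=
  continuous_pi fun _ => continuous_apply _

/-- The admissible impulses: nonnegative on hard constraints, free on soft constraints and in the
friction cone on contacts. -/
def admissibleImpulses (P : Parameters p s c) : Set (Row p s c → ℝ) :=
  {x | (∀ i : Fin p, 0 ≤ x (Sum.inl i)) ∧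
    ∀ i : Fin c, contactBlock i x ∈ frictionCone (P.friction i)}

theorem isClosed_admissibleImpulses (P : Parameters p s c) : IsClosed (admissibleImpulses P) := by
  have h : admissibleImpulses P = (⋂ i : Fin p, {x | 0 ≤ x (Sum.inl i)}) ∩
      ⋂ i : Fin c, contactBlock i ⁻¹' frictionCone (P.friction i) := by
    ext x; simp [admissibleImpulses]
  rw [h]
  exact (isClosed_iInter fun i => isClosed_le continuous_const (continuous_apply _)).inter
    (isClosed_iInter fun i =>
      (isClosed_frictionCone (P.friction i)).preimage (continuous_contactBlock i))

theorem convex_admissibleImpulses (P : Parameters p s c) : Convex ℝ (admissibleImpulses P) :=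
  fun _ hx _ hy _ _ ha hb hab =>
    ⟨fun i => add_nonneg (mul_nonneg ha (hx.1 i)) (mul_nonneg hb (hy.1 i)),
      fun i => convex_frictionCone (P.friction i) (hx.2 i) (hy.2 i) ha hb hab⟩

theorem zero_mem_admissibleImpulses (P : Parameters p s c) : 0 ∈ admissibleImpulses P :=
  ⟨fun _ => le_rfl, fun i => zero_mem_frictionCone (P.friction i)⟩

/-- The constant part of the term to be added to the constraint velocity. -/
noncomputable def errorShift (P : Parameters p s c) : Row p s c → ℝ :=
  Sum.elim P.hardError (Sum.elim (fun i => P.softGain i * P.softError i / P.softDamping i)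
    fun r => ![0, 0, P.contactError r.1] r.2)

/-- The part of the term to be added to the constraint velocity `z` that depends on `z` and on the
impulse `x`. -/
noncomputable def impulseShift (P : Parameters p s c) (z x : Row p s c → ℝ) : Row p s c → ℝ :=
  Sum.elim (fun _ => 0) (Sum.elim (fun i => x (Sum.inr (Sum.inl i)) / P.softDamping i)
    fun r => ![0, 0, P.friction r.1 * ‖tangential (contactBlock r.1 z)‖] r.2)

theorem continuous_impulseShift (P : Parameters p s c) {X : Type*} [TopologicalSpace X]
    {z x : X → Row p s c → ℝ} (hz : Continuous z) (hx : Continuous x) :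
    Continuous fun y => impulseShift P (z y) (x y) := by
  refine continuous_pi fun r => ?_
  rcases r with i | i | ⟨i, a⟩
  · exact continuous_const
  · exact ((continuous_apply _).comp hx).div_const _
  · fin_cases a
    · exact continuous_const
    · exact continuous_const
    · exact (continuous_tangential.comp ((continuous_contactBlock i).comp hz)).norm.const_mul _

/-- Soft rows contribute a square over the damping, normal rows a product of nonnegative factors.
This sign is what preserves coercivity. -/
theorem mul_impulseShift_nonneg {P : Parameters p s c} (hdamping : ∀ i, 0 < P.softDamping i)
    (hfriction : ∀ i, 0 ≤ P.friction i) (z : Row p s c → ℝ) {x : Row p s c → ℝ}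
    (hx : x ∈ admissibleImpulses P) (r : Row p s c) : 0 ≤ x r * impulseShift P z x r := by
  rcases r with i | i | ⟨i, a⟩
  · simp [impulseShift]
  · have := hdamping i
    simp only [impulseShift, Sum.elim_inr, Sum.elim_inl]
    rw [← mul_div_assoc]
    exact div_nonneg (mul_self_nonneg _) this.le
  · fin_cases a
    · simp [impulseShift]
    · simp [impulseShift]
    · exact mul_nonneg (hx.2 i).1 (mul_nonneg (hfriction i) (norm_nonneg _))

/-- A solution of the variational inequality over the admissible impulses lies, together with its
velocity, in the constraint set. -/
theorem mem_constraintSet_of_variationalInequality {P : Parameters p s c}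
    (hdamping : ∀ i, 0 < P.softDamping i) (hfriction : ∀ i, 0 ≤ P.friction i)
    {z l : Row p s c → ℝ} (hl : l ∈ admissibleImpulses P)
    (hVI : ∀ y ∈ admissibleImpulses P,
      0 ≤ (z + errorShift P + impulseShift P z l) ⬝ᵥ (y - l)) :
    (z, l) ∈ constraintSet P := by
  set G := z + errorShift P + impulseShift P z l with hG
  -- Hard and soft rows vary independently, so one-coordinate test vectors isolate them.
  have hrow : ∀ (r : Row p s c) (t : ℝ), G ⬝ᵥ (Function.update l r t - l) = G r * (t - l r) := by
    intro r t
    rw [dotProduct, Finset.sum_eq_single r]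
    · simp
    · intro r' _ hr'
      simp [Function.update_of_ne hr']
    · simp
  refine ⟨fun i => ?_, fun i => ?_, fun i => ?_⟩
  · have hGi : G (Sum.inl i) = z (Sum.inl i) + P.hardError i := by
      simp [hG, errorShift, impulseShift]
    have key : ∀ t, 0 ≤ t → 0 ≤ (z (Sum.inl i) + P.hardError i) * (t - l (Sum.inl i)) := by
      intro t ht
      rw [← hGi, ← hrow]
      refine hVI _ ⟨fun j => ?_, fun j => hl.2 j⟩
      by_cases hj : j = i
      · subst hj; simpa using ht
      · rw [Function.update_of_ne (by simpa using hj)]; exact hl.1 j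
    have h0 := hl.1 i
    have h1 := key 0 le_rfl
    have h2 := key (l (Sum.inl i) + 1) (by linarith)
    have h3 : 0 ≤ z (Sum.inl i) + P.hardError i := by linarith
    refine ⟨h0, h3, ?_⟩
    nlinarith [mul_nonneg h0 h3]
  · set r : Row p s c := Sum.inr (Sum.inl i) with hr
    have hb := hdamping i
    have key : ∀ t, 0 ≤ G r * (t - l r) := by
      intro t
      rw [← hrow]
      refine hVI _ ⟨fun j => ?_, fun j => ?_⟩
      · rw [Function.update_of_ne (by simp [hr])]; exact hl.1 j
      · have : contactBlock j (Function.update l r t) = contactBlock j l := by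
          ext a; exact Function.update_of_ne (by simp [hr]) _ _
        rw [this]; exact hl.2 j
    have h1 := key (l r + 1)
    have h2 := key (l r - 1)
    have h3 : G r = 0 := by linarith
    have hGr : G r = z r + P.softGain i * P.softError i / P.softDamping i +
        l r / P.softDamping i := by
      simp [hG, errorShift, impulseShift, hr]
    rw [hGr] at h3
    field_simp at h3
    change l r = -P.softGain i * P.softError i - P.softDamping i * z r
    linarith
  · refine signoriniCoulomb_of_variationalInequality (hfriction i) (hl.2 i) fun w hw => ?_
    -- The cone couples the three rows of a contact, so the whole block is replaced.
    set y : Row p s c → ℝ := Sum.elim (fun j => l (Sum.inl j)) (Sum.elim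
      (fun j => l (Sum.inr (Sum.inl j)))
      fun r => if r.1 = i then w r.2 else l (Sum.inr (Sum.inr r))) with hy
    have h1 : y ∈ admissibleImpulses P := by
      refine ⟨hl.1, fun j => ?_⟩
      by_cases hj : j = i
      · have : contactBlock j y = w := by ext a; simp [contactBlock, hy, hj]
        rw [this, hj]; exact hw
      · have : contactBlock j y = contactBlock j l := by ext a; simp [contactBlock, hy, hj]
        rw [this]; exact hl.2 j
    have h2 := hVI y h1
    rw [dotProduct, Fintype.sum_sum_type, Fintype.sum_sum_type, Fintype.sum_prod_type,
      Finset.sum_eq_single i (fun j _ hj => by simp [hy, hj]) (by simp)] at h2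
    simp only [hG, hy, errorShift, impulseShift, Fin.sum_univ_three, Pi.sub_apply, Pi.add_apply,
      Sum.elim_inl, Sum.elim_inr, sub_self, mul_zero, Finset.sum_const_zero, zero_add, if_true,
      Matrix.cons_val, add_zero] at h2
    have h3 : inner ℝ (tangential (contactBlock i z))
        (tangential w - tangential (contactBlock i l)) =
        z (Sum.inr (Sum.inr (i, 0))) * (w 0 - l (Sum.inr (Sum.inr (i, 0)))) +
        z (Sum.inr (Sum.inr (i, 1))) * (w 1 - l (Sum.inr (Sum.inr (i, 1)))) := by
      simp [PiLp.inner_apply, tangential, contactBlock, mul_comm]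
    change 0 ≤ inner ℝ (tangential (contactBlock i z))
        (tangential w - tangential (contactBlock i l)) + (z (Sum.inr (Sum.inr (i, 2))) +
        P.contactError i + P.friction i * ‖tangential (contactBlock i z)‖) *
        (w 2 - l (Sum.inr (Sum.inr (i, 2))))
    rw [h3]
    linarith

/-- The block system holds as soon as the velocity balances the impulse and the constraint velocity
is given by the augmented-Lagrangian update. -/
theorem surrogateMatrix_mulVec_eq {n : ℕ} {A : Matrix (Fin n) (Fin n) ℝ}
    {J : Matrix (Row p s c) (Fin n) ℝ} {β : ℝ} (hβ : β ≠ 0) {b v : Fin n → ℝ}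
    {u z l : Row p s c → ℝ} (hv : A *ᵥ v = b + Jᵀ *ᵥ l) (hz : z = J *ᵥ v + β⁻¹ • (u + l)) :
    surrogateMatrix A J β *ᵥ Sum.elim v z = Sum.elim (b - Jᵀ *ᵥ u) (u + l) := by
  rw [surrogateMatrix, fromBlocks_mulVec]
  congr 1
  · simp only [Sum.elim_comp_inl, Sum.elim_comp_inr, hz, add_mulVec, neg_mulVec, smul_mulVec,
      mulVec_add, mulVec_smul, hv, mulVec_mulVec, smul_add, Matrix.neg_mul, Matrix.smul_mul, smul_neg, smul_smul, inv_mul_cancel₀ hβ,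
      one_smul]
    abel
  · simp only [Sum.elim_comp_inl, Sum.elim_comp_inr, hz, neg_mulVec, smul_mulVec, one_mulVec,
      smul_add, smul_smul, mul_inv_cancel₀ hβ, one_smul]
    abel

end MultiContact

end Solve

/-! ### Existence for the surrogate problem. -/

open MultiContact Matrix in
theorem proposition1 {n p s c : ℕ} (P : MultiContact.Parameters p s c)
    (hgain : ∀ i, 0 < P.softGain i) (hdamping : ∀ i, 0 < P.softDamping i)
    (hfriction : ∀ i, 0 ≤ P.friction i)
    (A : Matrix (Fin n) (Fin n) ℝ) (hA : A.PosDef) (b : Fin n → ℝ)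
    (J : Matrix (MultiContact.Row p s c) (Fin n) ℝ)
    (β : ℝ) (hβ : 0 < β) (u : MultiContact.Row p s c → ℝ) :
    ∃ (v : Fin n → ℝ) (z l : MultiContact.Row p s c → ℝ),
      MultiContact.IsSurrogateSolution P A b J β u v z l := by
  set W : Matrix (Row p s c) (Row p s c) ℝ := β⁻¹ • 1 + J * A⁻¹ * Jᵀ with hWdef
  set q : Row p s c → ℝ := J *ᵥ A⁻¹ *ᵥ b + β⁻¹ • u with hq
  have hW : ∀ x : Row p s c → ℝ, β⁻¹ * (x ⬝ᵥ x) ≤ x ⬝ᵥ W *ᵥ x := by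
    intro x
    have h1 := (hA.inv.posSemidef.mul_mul_conjTranspose_same J).dotProduct_mulVec_nonneg x
    simp only [star_trivial, conjTranspose_eq_transpose_of_trivial] at h1
    rw [hWdef, add_mulVec, smul_mulVec, one_mulVec, dotProduct_add, dotProduct_smul, smul_eq_mul]
    linarith
  have hzc : Continuous fun x : Row p s c → ℝ => W *ᵥ x + q :=
    (Continuous.matrix_mulVec continuous_const continuous_id).add continuous_const
  -- The perturbation is the impulse shift evaluated at the velocity `W *ᵥ x + q` that `x` itself
  -- induces.
  obtain ⟨l, hl, hVI⟩ := exists_variationalInequality_mulVec_add (isClosed_admissibleImpulses P)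
    (convex_admissibleImpulses P) (zero_mem_admissibleImpulses P) (inv_pos.2 hβ) hW
    (q + errorShift P) (continuous_impulseShift P hzc continuous_id)
    fun x hx r => mul_impulseShift_nonneg hdamping hfriction _ hx r
  refine ⟨A⁻¹ *ᵥ (b + Jᵀ *ᵥ l), W *ᵥ l + q, l, surrogateMatrix_mulVec_eq hβ.ne' ?_ ?_,
    mem_constraintSet_of_variationalInequality hdamping hfriction hl ?_⟩
  · rw [mulVec_mulVec, mul_nonsing_inv _ ((isUnit_iff_isUnit_det A).1 hA.isUnit), one_mulVec]
  · simp only [hWdef, hq, add_mulVec, smul_mulVec, one_mulVec, mulVec_add, ← mulVec_mulVec,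
      smul_add]
    abel
  · simpa only [add_assoc, id_eq] using hVI
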